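/- For $1<a\le 2$ and $1-\frac1a\le p\le \frac1a$ define maps $f_{(a,p,-)},f_{(a,p,+)}:[0,1]\to[0,1]$ (the uniform overlapping maps): $f_{(a,p,-)}(x)=ax$ if $x\le p$ and $f_{(a,p,-)}(x)=ax+1-a$ if $x>p$; $f_{(a,p,+)}(x)=ax$ if $x<p$ and $f_{(a,p,+)}(x)=ax+1-a$ if $x\ge p$. The itinerary of $x$ under $f_{(a,p,\pm)}$ is the binary string $\omega_0\omega_1\omega_2\cdots$ with $\omega_n=0$ if $f_{(a,p,\pm)}^{n}(x)\in I_0$ and $\omega_n=1$ otherwise, where $I_0=[0,p]$ for $f_{(a,p,-)}$ and $I_0=[0,p)$ for $f_{(a,p,+)}$; the critical itinerary of $f_{(a,p,\pm)}$ is the itinerary of $p$. Order the set $\Omega=\{0,1\}^{\infty}$ of infinite binary strings lexicographically and let $S$ be the shift, $S(\omega_0\omega_1\omega_2\cdots)=\omega_1\omega_2\cdots$. A pair $(\alpha,\beta)$ of strings is admissible if $\alpha_0=0$, $\alpha_1=1$, $\beta_0=1$, $\beta_1=0$ and, for all $n\ge 0$, $S^n\alpha\notin(\alpha,\beta]$ and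 $S^n\beta\notin[\alpha,\beta)$. Let $\Omega_{(\alpha,\beta)}$ be the set of strings $\omega$ such that $S^n\omega\notin(\alpha,\beta]$ for all $n\ge0$, or $S^n\omega\notin[\alpha,\beta)$ for all $n\ge 0$. The pair is null if $\limsup_{n\to\infty}\frac1n\ln|\Gamma_n|=0$, where $\Gamma_n$ is the set of initial strings $\omega_0\omega_1\cdots\omega_n$ of the elements $\omega$ of $\Omega_{(\alpha,\beta)}$. Let $\alpha=0110101000101\cdots$ be the string with $\alpha_n=1$ if and only if $n+1$ is prime ($n\ge0$), and let $\beta=1000\cdots$. Then the pair $(\alpha,\beta)$ is admissible and non-null. Moreover, the equation $\sum_{n=0}^\infty\alpha_nx^n=\sum_{n=0}^\infty\beta_nx^n$ has a smallest solution $r$ in $[0,1)$, and for $a=1/r$ and $p=(1-r)\sum_{n=0}^\infty\alpha_nr^n$ the following hold: 1. $1<a\le2$ and $1-\frac1a\le p\le\frac1a$; 2. $a\approx 1.792568768$ and $p\approx .4421413462$, more precisely $|a-1.792568768|<10^{-9}$ and $|p-0.4421413462|<10^{-10}$; 3. $\alpha$ and $\beta$ are the critical itineraries of $f_{(a,p,-)}$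 and $f_{(a,p,+)}$, respectively; 4. a natural number $n\ge1$ is prime if and only if $f_{(a,p,-)}^{\,n-1}(p)>p$. -/

import Mathlib

open Set Filter

/-- The overlapping function with the left branch closed at `p`. -/
noncomputable def overlapMinus (a p x : ℝ) : ℝ :=
  if x ≤ p then a * x else a * x + (1 - a)

/-- The overlapping function with the right branch closed at `p`. -/
noncomputable def overlapPlus (a p x : ℝ) : ℝ :=
  if x < p then a * x else a * x + (1 - a)

/-- The parameter range of uniform overlapping functions. -/
structure IsOverlapping (a p : ℝ) : Prop where
  one_lt : 1 < a
  le_two : a ≤ 2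
  lower : 1 - 1 / a ≤ p
  upper : p ≤ 1 / a

/-- Both functions map the unit interval to itself, so that their iterates on `[0,1]` may be
computed with the formulas on the real line. -/
theorem IsOverlapping.mapsTo {a p : ℝ} (h : IsOverlapping a p) :
    MapsTo (overlapMinus a p) (Icc 0 1) (Icc 0 1) ∧
      MapsTo (overlapPlus a p) (Icc 0 1) (Icc 0 1) := by
  have ha : 0 < a := by linarith [h.one_lt]
  have h1 : a * (1 / a) = 1 := by field_simp
  have hl := mul_le_mul_of_nonneg_left h.lower ha.le
  have hu := mul_le_mul_of_nonneg_left h.upper ha.le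
  constructor
  · rintro x ⟨hx0, hx1⟩
    unfold overlapMinus
    split_ifs with hx <;> constructor <;> nlinarith
  · rintro x ⟨hx0, hx1⟩
    unfold overlapPlus
    split_ifs with hx <;> constructor <;> nlinarith

/-- Infinite binary strings `ω 0, ω 1, ω 2, …`. -/
abbrev BinString : Type := ℕ → Fin 2

open Classical in
/-- The itinerary of `x ∈ [0,1]` under `overlapMinus a p`, for the intervals
`[0,p]` (symbol `0`) and `(p,1]` (symbol `1`). -/
noncomputable def itineraryMinus (a p x : ℝ) : BinString := fun n =>
  if (overlapMinus a p)^[n] x ∈ Icc 0 p then 0 else 1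

open Classical in
/-- The itinerary of `x ∈ [0,1]` under `overlapPlus a p`, for the intervals
`[0,p)` (symbol `0`) and `[p,1]` (symbol `1`). -/
noncomputable def itineraryPlus (a p x : ℝ) : BinString := fun n =>
  if (overlapPlus a p)^[n] x ∈ Ico 0 p then 0 else 1

/-- The shift operator, dropping the first symbol. -/
def shift (ω : BinString) : BinString := fun n => ω (n + 1)

/-- Admissible pairs; `toLex` makes the intervals those of the lexicographic order. -/
structure IsAdmissible (α β : BinString) : Prop where
  left_zero : α 0 = 0
  left_one : α 1 = 1
  right_zero : β 0 = 1
  right_one : β 1 = 0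
  left_shift : ∀ n : ℕ, toLex (shift^[n] α) ∉ Ioc (toLex α) (toLex β)
  right_shift : ∀ n : ℕ, toLex (shift^[n] β) ∉ Ico (toLex α) (toLex β)

def addressSpaceMinus (α β : BinString) : Set BinString :=
  {ω | ∀ n : ℕ, toLex (shift^[n] ω) ∉ Ioc (toLex α) (toLex β)}

def addressSpacePlus (α β : BinString) : Set BinString :=
  {ω | ∀ n : ℕ, toLex (shift^[n] ω) ∉ Ico (toLex α) (toLex β)}

def addressSpace (α β : BinString) : Set BinString :=
  addressSpaceMinus α β ∪ addressSpacePlus α β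

/-- The initial strings `ω 0, …, ω n` of length `n + 1` of the members of `Γ`. -/
def initialStrings (Γ : Set BinString) (n : ℕ) : Set (Fin (n + 1) → Fin 2) :=
  (fun ω i => ω i) '' Γ

/-- The exponential growth rate of a nonempty set of strings. -/
noncomputable def growthRate (Γ : Set BinString) : EReal :=
  limsup (fun n : ℕ => ((1 / (n : ℝ) * Real.log ((initialStrings Γ n).ncard : ℝ) : ℝ) : EReal))
    atTop

def IsNull (α β : BinString) : Prop := growthRate (addressSpace α β) = 0

/-- The power series `∑ ωₙ xⁿ`, convergent for `|x| < 1`. -/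
noncomputable def stringSeries (ω : BinString) (x : ℝ) : ℝ := ∑' n : ℕ, ((ω n : ℕ) : ℝ) * x ^ n

/-- The string `0110101000101…` with symbol `1` at index `n` exactly when `n + 1` is prime. -/
def primeString : BinString := fun n => if (n + 1).Prime then 1 else 0

/-- The string `1000…`. -/
def oneZeros : BinString := fun n => if n = 0 then 1 else 0

/-!
The series of `oneZeros` is the constant `1`, so the equation reads `A x = 1`, where
`A x = ∑ₙ αₙ xⁿ` is the series of the prime string `α`. As `A` is continuous and strictly increasing
on `[0,1)`, the equation has exactly one solution `r` there, and the values of `A` at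
`0.5578586537` and `0.5578586539`, each computed from the first `48` terms and (for the lower
one) a geometric bound on the tail, enclose it. Consequently `p = 1 - r = 1 - 1/a`, so that
`overlapPlus a p` maps `p` to its fixed point `0`, which gives the itinerary `1000…`.

The heart of the matter is the itinerary under `overlapMinus a p`. Write
`Tₙ = ∑ₖ αₙ₊ₖ rᵏ` for the series of the `n`-th shift. Then `Tₙ = αₙ + r Tₙ₊₁`, and this is the
recursion of the orbit of `p`: its `n`-th point is `(1 - r) Tₙ`, as long as the branch taken at
each step is the one named by `αₙ`, that is, as long as `Tₙ > 1` exactly when `αₙ = 1`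
(`overlapMinus_iterate`). If `αₙ = 1`, then `Tₙ > 1` because there are infinitely many primes.
If `αₙ = 0` and `n ≥ 1`, then `n + 1 ≥ 4`, and no two consecutive integers from there on are both
prime; a string that begins with `0` and has no two adjacent ones has series at most
`r / (1 - r²) < 1` (`stringSeries_le_of_isolated`). The same two facts, that consecutive
integers above `3` are not both prime and that there are infinitely many primes, give admissibility.

Finally the pair is not null because every string that vanishes at the even places lies in
`addressSpacePlus`: a shift of it that starts with `0` cannot start with `011`. Such strings have
at least `2 ^ ((n + 1) / 2)` initial strings of length `n + 1`.
-/

/-! ### Strings and the lexicographic order -/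

theorem shift_iterate_apply (ω : BinString) (n k : ℕ) : shift^[n] ω k = ω (k + n) := by
  induction n generalizing k with
  | zero => rfl
  | succ n ih =>
    rw [Function.iterate_succ_apply']
    change shift^[n] ω (k + 1) = _
    rw [ih]
    congr 1
    omega

theorem toLex_lt_of_first_difference {x y : BinString} (i : ℕ) (h : ∀ j < i, x j = y j)
    (hi : x i < y i) : toLex x < toLex y :=
  ⟨i, h, hi⟩

theorem fin_two_eq_zero_of_ne_one {x : Fin 2} (h : x ≠ 1) : x = 0 := by omega

theorem oneZeros_lt {ω : BinString} (h0 : ω 0 = 1) {k : ℕ} (hk : 0 < k) (h1 : ω k = 1) :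
    toLex oneZeros < toLex ω := by
  classical
  have hex : ∃ j, 0 < j ∧ ω j = 1 := ⟨k, hk, h1⟩
  refine toLex_lt_of_first_difference (Nat.find hex) (fun j hj => ?_) ?_
  · rcases Nat.eq_zero_or_pos j with rfl | hj0
    · simp [oneZeros, h0]
    · have := Nat.find_min hex hj
      have hz : ω j = 0 := fin_two_eq_zero_of_ne_one fun h => this ⟨hj0, h⟩
      simp [oneZeros, hj0.ne', hz]
  · have := Nat.find_spec hex
    rw [this.2]
    simp [oneZeros, this.1.ne']

theorem oneZeros_le {ω : BinString} (h0 : ω 0 = 1) : toLex oneZeros ≤ toLex ω := by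
  by_cases h : ∃ k, 0 < k ∧ ω k = 1
  · obtain ⟨k, hk, h1⟩ := h
    exact (oneZeros_lt h0 hk h1).le
  · push Not at h
    have : oneZeros = ω := by
      funext k
      rcases Nat.eq_zero_or_pos k with rfl | hk
      · simp [oneZeros, h0]
      · simp [oneZeros, hk.ne', fin_two_eq_zero_of_ne_one (h k hk)]
    rw [this]

/-! ### The prime string -/

theorem primeString_eq_one_iff {n : ℕ} : primeString n = 1 ↔ (n + 1).Prime := by
  simp [primeString]

theorem primeString_eq_zero_iff {n : ℕ} : primeString n = 0 ↔ ¬ (n + 1).Prime := by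
  simp [primeString]

theorem exists_primeString_eq_one (n : ℕ) : ∃ k, 0 < k ∧ primeString (k + n) = 1 := by
  obtain ⟨q, hq, hp⟩ := Nat.exists_infinite_primes (n + 2)
  refine ⟨q - (n + 1), by omega, ?_⟩
  rw [primeString_eq_one_iff]
  convert hp using 1
  omega

theorem primeString_isolated {n : ℕ} (hn : 2 ≤ n) (h : primeString n = 1) :
    primeString (n + 1) = 0 := by
  rw [primeString_eq_one_iff] at h
  rw [primeString_eq_zero_iff]
  intro h'
  rcases h.eq_two_or_odd with h2 | h2 <;> rcases h'.eq_two_or_odd with h3 | h3 <;> omega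

/-- The prime string begins with `011`, so a string with first symbol `0` that does not begin with
`011` is smaller. -/
theorem toLex_lt_primeString {ω : BinString} (h0 : ω 0 = 0) (h : ω 1 = 1 → ω 2 = 0) :
    toLex ω < toLex primeString := by
  have a0 : primeString 0 = 0 := by norm_num [primeString]
  have a1 : primeString 1 = 1 := by norm_num [primeString]
  have a2 : primeString 2 = 1 := by norm_num [primeString]
  by_cases h1 : ω 1 = 1
  · refine toLex_lt_of_first_difference 2 (fun j hj => ?_) (by simp [h h1, a2])
    interval_cases j
    · rw [h0, a0]
    · rw [h1, a1]
  · refine toLex_lt_of_first_difference 1 (fun j hj => ?_)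
      (by simp [fin_two_eq_zero_of_ne_one h1, a1])
    interval_cases j
    rw [h0, a0]

theorem two_le_of_primeString_eq_zero {n : ℕ} (hn : n ≠ 0) (h : primeString n = 0) : 2 ≤ n := by
  rw [primeString_eq_zero_iff] at h
  by_contra hlt
  obtain rfl : n = 1 := by omega
  exact h Nat.prime_two

theorem isAdmissible_primeString_oneZeros : IsAdmissible primeString oneZeros where
  left_zero := by norm_num [primeString]
  left_one := by norm_num [primeString]
  right_zero := by simp [oneZeros]
  right_one := by simp [oneZeros]
  left_shift n := by
    rintro ⟨hl, hr⟩
    by_cases h1 : primeString n = 1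
    · obtain ⟨k, hk, h⟩ := exists_primeString_eq_one n
      refine absurd hr (not_le.2 (oneZeros_lt ?_ hk ?_))
      · rw [shift_iterate_apply, Nat.zero_add, h1]
      · rw [shift_iterate_apply, h]
    · have h0 := fin_two_eq_zero_of_ne_one h1
      rcases eq_or_ne n 0 with rfl | hn
      · exact absurd hl (lt_irrefl _)
      · have h2 := two_le_of_primeString_eq_zero hn h0
        refine absurd hl (toLex_lt_primeString ?_ ?_).not_gt
        · rw [shift_iterate_apply, Nat.zero_add, h0]
        · rw [shift_iterate_apply, shift_iterate_apply]
          intro h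
          have := primeString_isolated (by omega) h
          rwa [show 2 + n = 1 + n + 1 by omega]
  right_shift n := by
    rintro ⟨hl, hr⟩
    rcases eq_or_ne n 0 with rfl | hn
    · exact absurd hr (lt_irrefl _)
    · refine absurd hl (toLex_lt_primeString ?_ fun _ => ?_).not_ge <;>
        rw [shift_iterate_apply] <;> simp [oneZeros, hn]

/-! ### Positive growth rate -/

/-- A string that vanishes at the even places has no shift in `[α, β)`: a shift with first symbol
`1` is at least `1000…`, and one with first symbol `0` has no two adjacent ones. -/
theorem mem_addressSpacePlus_of_even {ω : BinString} (h : ∀ n, ω (2 * n) = 0) :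
    ω ∈ addressSpacePlus primeString oneZeros := by
  rintro n ⟨hl, hr⟩
  by_cases h1 : shift^[n] ω 0 = 1
  · exact absurd hr (oneZeros_le h1).not_gt
  · refine absurd hl (toLex_lt_primeString (fin_two_eq_zero_of_ne_one h1) ?_).not_ge
    rw [shift_iterate_apply, shift_iterate_apply]
    rcases Nat.even_or_odd' n with ⟨m, rfl | rfl⟩
    · rw [show 2 + 2 * m = 2 * (m + 1) by omega, h]
      simp
    · rw [show 1 + (2 * m + 1) = 2 * (m + 1) by omega, h]
      simp

theorem two_pow_le_ncard_initialStrings (n : ℕ) :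
    2 ^ ((n + 1) / 2) ≤ (initialStrings (addressSpace primeString oneZeros) n).ncard := by
  classical
  -- The symbols of `b` are placed at the indices `1, 3, 5, …`.
  let spread (b : Fin ((n + 1) / 2) → Fin 2) : BinString := fun i =>
    if h : i % 2 = 1 ∧ i / 2 < (n + 1) / 2 then b ⟨i / 2, h.2⟩ else 0
  have hmem : ∀ b, (fun i : Fin (n + 1) => spread b i) ∈
      initialStrings (addressSpace primeString oneZeros) n := fun b =>
    ⟨spread b, Or.inr (mem_addressSpacePlus_of_even fun m => by simp [spread]), rfl⟩
  have hinj : Function.Injective fun b => fun i : Fin (n + 1) => spread b i := by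
    intro b c hbc
    funext j
    have hj := j.2
    have := congrFun hbc ⟨2 * j + 1, by omega⟩
    have h1 : (2 * (j : ℕ) + 1) % 2 = 1 := by omega
    have h2 : (2 * (j : ℕ) + 1) / 2 = j := by omega
    simpa [spread, h1, h2] using this
  calc 2 ^ ((n + 1) / 2) = (range fun b => fun i : Fin (n + 1) => spread b i).ncard := by
        rw [← Set.image_univ, Set.ncard_image_of_injective _ hinj, Set.ncard_univ]
        simp
    _ ≤ _ := Set.ncard_le_ncard (by rintro _ ⟨b, rfl⟩; exact hmem b) (Set.toFinite _)

theorem not_isNull_primeString_oneZeros : ¬ IsNull primeString oneZeros := by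
  have hlog : 0 < Real.log 2 := Real.log_pos one_lt_two
  have key : ((Real.log 2 / 2 : ℝ) : EReal) ≤
      growthRate (addressSpace primeString oneZeros) := by
    refine le_limsup_of_frequently_le (Eventually.frequently ?_)
    filter_upwards [eventually_ge_atTop 1] with n hn
    rw [EReal.coe_le_coe_iff]
    have hn' : (0 : ℝ) < n := by exact_mod_cast hn
    have h1 : (n : ℝ) ≤ 2 * (((n + 1) / 2 : ℕ) : ℝ) := by
      exact_mod_cast (by omega : n ≤ 2 * ((n + 1) / 2))
    have h2 : Real.log ((2 : ℝ) ^ ((n + 1) / 2)) ≤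
        Real.log ((initialStrings (addressSpace primeString oneZeros) n).ncard : ℝ) :=
      Real.log_le_log (by positivity) (by exact_mod_cast two_pow_le_ncard_initialStrings n)
    rw [Real.log_pow] at h2
    rw [one_div, inv_mul_eq_div, le_div_iff₀ hn']
    nlinarith
  intro h
  rw [h, ← EReal.coe_zero, EReal.coe_le_coe_iff] at key
  linarith

/-! ### Power series of strings -/

theorem symbol_cast_nonneg_le_one (ω : BinString) (n : ℕ) :
    (0 : ℝ) ≤ ((ω n : ℕ) : ℝ) ∧ ((ω n : ℕ) : ℝ) ≤ 1 :=
  ⟨by positivity, by exact_mod_cast Nat.lt_succ_iff.1 (ω n).2⟩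

theorem summable_stringSeries (ω : BinString) {x : ℝ} (h0 : 0 ≤ x) (h1 : x < 1) :
    Summable fun n => ((ω n : ℕ) : ℝ) * x ^ n :=
  Summable.of_nonneg_of_le (fun _ => by positivity)
    (fun n => mul_le_of_le_one_left (by positivity) (symbol_cast_nonneg_le_one ω n).2)
    (summable_geometric_of_lt_one h0 h1)

theorem stringSeries_nonneg (ω : BinString) {x : ℝ} (h0 : 0 ≤ x) : 0 ≤ stringSeries ω x :=
  tsum_nonneg fun _ => by positivity

theorem stringSeries_le (ω : BinString) {x : ℝ} (h0 : 0 ≤ x) (h1 : x < 1) :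
    stringSeries ω x ≤ (1 - x)⁻¹ := by
  rw [← tsum_geometric_of_lt_one h0 h1]
  exact (summable_stringSeries ω h0 h1).tsum_le_tsum
    (fun n => mul_le_of_le_one_left (by positivity) (symbol_cast_nonneg_le_one ω n).2)
    (summable_geometric_of_lt_one h0 h1)

theorem stringSeries_split (ω : BinString) (N : ℕ) {x : ℝ} (h0 : 0 ≤ x) (h1 : x < 1) :
    stringSeries ω x =
      ∑ n ∈ Finset.range N, ((ω n : ℕ) : ℝ) * x ^ n + x ^ N * stringSeries (shift^[N] ω) x := by
  unfold stringSeries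
  rw [← (summable_stringSeries ω h0 h1).sum_add_tsum_nat_add N, ← tsum_mul_left]
  congr 1
  refine tsum_congr fun n => ?_
  rw [shift_iterate_apply]
  ring

theorem stringSeries_eq_head_add (ω : BinString) {x : ℝ} (h0 : 0 ≤ x) (h1 : x < 1) :
    stringSeries ω x = ((ω 0 : ℕ) : ℝ) + x * stringSeries (shift ω) x := by
  simpa using stringSeries_split ω 1 h0 h1

theorem stringSeries_oneZeros (x : ℝ) : stringSeries oneZeros x = 1 := by
  unfold stringSeries
  rw [tsum_eq_single 0 fun n hn => by simp [oneZeros, hn]]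
  simp [oneZeros]

theorem stringSeries_pos {ω : BinString} {k : ℕ} (hk : ω k = 1) {x : ℝ} (h0 : 0 < x)
    (h1 : x < 1) : 0 < stringSeries ω x :=
  (summable_stringSeries ω h0.le h1).tsum_pos (fun _ => by positivity) k (by simp [hk, h0])

theorem one_lt_stringSeries {ω : BinString} (hω : ω 0 = 1) {k : ℕ} (hk : 0 < k) (h : ω k = 1)
    {x : ℝ} (h0 : 0 < x) (h1 : x < 1) : 1 < stringSeries ω x := by
  have hs : 0 < stringSeries (shift ω) x := by
    refine stringSeries_pos (k := k - 1) ?_ h0 h1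
    rw [← h]
    exact congrArg ω (by omega)
  rw [stringSeries_eq_head_add ω h0.le h1, hω]
  have := mul_pos h0 hs
  simpa using this

/-- Since `ωₙ + ωₙ₊₁ ≤ 1`, the series of `ω` and of its shift add up to at most `∑ xⁿ`, while
the first is `x` times the second. -/
theorem stringSeries_le_of_isolated {ω : BinString} (hω : ω 0 = 0)
    (h : ∀ n, ω n = 1 → ω (n + 1) = 0) {x : ℝ} (h0 : 0 ≤ x) (h1 : x < 1) :
    stringSeries ω x ≤ x / (1 - x ^ 2) := by
  have hsum : stringSeries ω x + stringSeries (shift ω) x ≤ (1 - x)⁻¹ := by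
    have s1 := summable_stringSeries ω h0 h1
    have s2 := summable_stringSeries (shift ω) h0 h1
    rw [← tsum_geometric_of_lt_one h0 h1]
    unfold stringSeries
    rw [← s1.tsum_add s2]
    refine (s1.add s2).tsum_le_tsum (fun n => ?_) (summable_geometric_of_lt_one h0 h1)
    rw [← add_mul]
    refine mul_le_of_le_one_left (by positivity) ?_
    by_cases hn : ω n = 1
    · simp [shift, h n hn, hn]
    · rw [fin_two_eq_zero_of_ne_one hn]
      simpa using (symbol_cast_nonneg_le_one (shift ω) n).2
  have hhead := stringSeries_eq_head_add ω h0 h1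
  rw [hω] at hhead
  have hx : 0 < 1 - x := by linarith
  have hinv : (1 - x) * (1 - x)⁻¹ = 1 := mul_inv_cancel₀ hx.ne'
  have hmul := mul_le_mul_of_nonneg_left hsum (mul_nonneg h0 hx.le)
  rw [le_div_iff₀ (by nlinarith)]
  simp only [Fin.val_zero, Nat.cast_zero, zero_add] at hhead
  calc stringSeries ω x * (1 - x ^ 2)
      = x * (1 - x) * stringSeries ω x + (1 - x) * stringSeries ω x := by ring
    _ = x * (1 - x) * stringSeries ω x + (1 - x) * (x * stringSeries (shift ω) x) := by
        rw [← hhead]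
    _ = x * (1 - x) * (stringSeries ω x + stringSeries (shift ω) x) := by ring
    _ ≤ x * (1 - x) * (1 - x)⁻¹ := hmul
    _ = x := by rw [mul_assoc, hinv, mul_one]

theorem continuousOn_stringSeries (ω : BinString) {b : ℝ} (h0 : 0 ≤ b) (h1 : b < 1) :
    ContinuousOn (stringSeries ω) (Icc 0 b) := by
  refine continuousOn_tsum (fun n => by fun_prop) (summable_geometric_of_lt_one h0 h1) ?_
  rintro n x ⟨hx0, hxb⟩
  rw [Real.norm_of_nonneg (by positivity)]
  calc ((ω n : ℕ) : ℝ) * x ^ n ≤ x ^ n :=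
        mul_le_of_le_one_left (by positivity) (symbol_cast_nonneg_le_one ω n).2
    _ ≤ b ^ n := pow_le_pow_left₀ hx0 hxb n

theorem stringSeries_lt_stringSeries {ω : BinString} {k : ℕ} (hk : k ≠ 0) (hω : ω k = 1)
    {x y : ℝ} (h0 : 0 ≤ x) (hxy : x < y) (h1 : y < 1) :
    stringSeries ω x < stringSeries ω y := by
  refine Summable.tsum_lt_tsum (i := k) (fun n => ?_) ?_
    (summable_stringSeries ω h0 (hxy.trans h1)) (summable_stringSeries ω (h0.trans hxy.le) h1)
  · exact mul_le_mul_of_nonneg_left (pow_le_pow_left₀ h0 hxy.le n) (by positivity)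
  · simpa [hω] using pow_lt_pow_left₀ hxy h0 hk

/-! ### The smallest solution -/

/-- The terms of the series with index below `48`, one for each prime up to `47`. -/
theorem sum_range_primeString (x : ℝ) :
    ∑ n ∈ Finset.range 48, ((primeString n : ℕ) : ℝ) * x ^ n =
      x + x ^ 2 + x ^ 4 + x ^ 6 + x ^ 10 + x ^ 12 + x ^ 16 + x ^ 18 + x ^ 22 + x ^ 28 + x ^ 30 +
        x ^ 36 + x ^ 40 + x ^ 42 + x ^ 46 := by
  simp only [Finset.sum_range_succ, Finset.sum_range_zero, primeString]
  norm_num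

theorem stringSeries_primeString_lower : stringSeries primeString 0.5578586537 < 1 := by
  rw [stringSeries_split primeString 48 (by norm_num) (by norm_num), sum_range_primeString]
  have htail := mul_le_mul_of_nonneg_left
    (stringSeries_le (shift^[48] primeString) (x := 0.5578586537) (by norm_num) (by norm_num))
    (by norm_num : (0 : ℝ) ≤ 0.5578586537 ^ 48)
  refine lt_of_le_of_lt (by gcongr) (?_ : _ + (0.5578586537 : ℝ) ^ 48 * (1 - 0.5578586537)⁻¹ < 1)
  norm_num

theorem stringSeries_primeString_upper : 1 < stringSeries primeString 0.5578586539 := by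
  rw [stringSeries_split primeString 48 (by norm_num) (by norm_num), sum_range_primeString]
  refine lt_of_lt_of_le ?_ (le_add_of_nonneg_right
    (mul_nonneg (by norm_num) (stringSeries_nonneg _ (by norm_num))))
  norm_num

theorem exists_stringSeries_primeString_eq_one :
    ∃ r : ℝ, 0.5578586537 < r ∧ r < 0.5578586539 ∧ stringSeries primeString r = 1 := by
  have hc : ContinuousOn (stringSeries primeString) (Icc 0.5578586537 0.5578586539) :=
    (continuousOn_stringSeries primeString (by norm_num) (by norm_num)).mono
      (Icc_subset_Icc_left (by norm_num))
  obtain ⟨r, hr, h⟩ := intermediate_value_Ioo (by norm_num) hc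
    ⟨stringSeries_primeString_lower, stringSeries_primeString_upper⟩
  exact ⟨r, hr.1, hr.2, h⟩

theorem isLeast_of_stringSeries_primeString_eq_one {r : ℝ} (h0 : 0 ≤ r) (h1 : r < 1)
    (h : stringSeries primeString r = 1) :
    IsLeast {x : ℝ | x ∈ Set.Ico (0 : ℝ) 1 ∧
      stringSeries primeString x = stringSeries oneZeros x} r := by
  refine ⟨⟨⟨h0, h1⟩, by rw [h, stringSeries_oneZeros]⟩, ?_⟩
  rintro x ⟨⟨hx0, _⟩, hx⟩
  rw [stringSeries_oneZeros] at hx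
  by_contra hlt
  have := stringSeries_lt_stringSeries one_ne_zero
    (primeString_eq_one_iff.2 Nat.prime_two) hx0 (not_le.1 hlt) h1
  linarith

/-! ### Orbits of the critical point -/

/-- If the series of the shifts of `ω` at `1 / a` lie on the sides of `1` that the symbols of `ω`
prescribe, then they are, up to the factor `p = 1 - 1 / a`, the orbit of `p` under
`overlapMinus a p`. -/
theorem overlapMinus_iterate {ω : BinString} {r : ℝ} (h0 : 0 < r) (h1 : r < 1)
    (hω : stringSeries ω r = 1)
    (hside : ∀ n, ω n = 1 ↔ 1 < stringSeries (shift^[n] ω) r) (n : ℕ) :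
    (overlapMinus (1 / r) (1 - r))^[n] (1 - r) = (1 - r) * stringSeries (shift^[n] ω) r := by
  induction n with
  | zero => simp [hω]
  | succ n ih =>
    rw [Function.iterate_succ_apply', ih, Function.iterate_succ_apply',
      stringSeries_eq_head_add (shift^[n] ω) h0.le h1]
    have hs := hside n
    rw [stringSeries_eq_head_add (shift^[n] ω) h0.le h1] at hs
    have h0n : shift^[n] ω 0 = ω n := by rw [shift_iterate_apply, Nat.zero_add]
    rw [h0n] at hs ⊢
    have hr : 0 < 1 - r := by linarith
    unfold overlapMinus
    by_cases hn : ω n = 1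
    · have hlt := hs.1 hn
      rw [if_neg (by nlinarith), hn]
      simp only [Fin.val_one, Nat.cast_one]
      field_simp
      ring
    · have hle := not_lt.1 (mt hs.2 hn)
      rw [if_pos (by nlinarith), fin_two_eq_zero_of_ne_one hn]
      simp only [Fin.val_zero, Nat.cast_zero]
      field_simp
      ring

/-- The bound `0.6` only serves to make `r / (1 - r ^ 2) ≤ 1`; at `n = 0` the series is exactly `1`,
so the symbol `0` goes with the closed side. -/
theorem primeString_eq_one_iff_one_lt_stringSeries {r : ℝ} (h0 : 0 < r) (h1 : r < 0.6)
    (h : stringSeries primeString r = 1) (n : ℕ) :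
    primeString n = 1 ↔ 1 < stringSeries (shift^[n] primeString) r := by
  have hhead : shift^[n] primeString 0 = primeString n := by
    rw [shift_iterate_apply, Nat.zero_add]
  constructor
  · intro hn
    obtain ⟨k, hk, hk1⟩ := exists_primeString_eq_one n
    exact one_lt_stringSeries (by rw [hhead, hn]) hk (by rw [shift_iterate_apply, hk1]) h0
      (by linarith)
  · intro hlt
    by_contra hn
    have hz := fin_two_eq_zero_of_ne_one hn
    rcases eq_or_ne n 0 with rfl | hn0
    · exact absurd hlt (by simp [h])
    · have h2 := two_le_of_primeString_eq_zero hn0 hz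
      have hle := stringSeries_le_of_isolated (ω := shift^[n] primeString) (by rw [hhead, hz])
        (fun k hk => by
          rw [shift_iterate_apply] at hk ⊢
          rw [show k + 1 + n = k + n + 1 by omega]
          exact primeString_isolated (by omega) hk) h0.le (by linarith)
      have : r / (1 - r ^ 2) ≤ 1 := by
        rw [div_le_one (by nlinarith)]
        nlinarith
      linarith

theorem itineraryPlus_critical {r : ℝ} (h0 : 0 < r) (h1 : r < 1) :
    itineraryPlus (1 / r) (1 - r) (1 - r) = oneZeros := by
  have hp : 0 < 1 - r := by linarith
  have hfirst : overlapPlus (1 / r) (1 - r) (1 - r) = 0 := by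
    rw [overlapPlus, if_neg (lt_irrefl _)]
    field_simp
    ring
  have hfix : overlapPlus (1 / r) (1 - r) 0 = 0 := by
    rw [overlapPlus, if_pos hp, mul_zero]
  funext n
  cases n with
  | zero => simp [itineraryPlus, oneZeros]
  | succ n =>
    rw [itineraryPlus, Function.iterate_succ_apply, hfirst, Function.iterate_fixed hfix,
      if_pos ⟨le_rfl, hp⟩]
    simp [oneZeros]

theorem isOverlapping_one_div {r : ℝ} (h0 : 1 / 2 ≤ r) (h1 : r < 1) :
    IsOverlapping (1 / r) (1 - r) where
  one_lt := (one_lt_div (by linarith)).2 h1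
  le_two := (div_le_iff₀ (by linarith)).2 (by linarith)
  lower := by rw [one_div_one_div]
  upper := by rw [one_div_one_div]; linarith

theorem mainTheorem5 :
    IsAdmissible primeString oneZeros ∧ ¬ IsNull primeString oneZeros ∧
    ∃ r a p : ℝ,
      IsLeast {x : ℝ | x ∈ Set.Ico (0 : ℝ) 1 ∧
        stringSeries primeString x = stringSeries oneZeros x} r ∧
      a = 1 / r ∧ p = (1 - r) * stringSeries primeString r ∧
      IsOverlapping a p ∧
      |a - 1.792568768| < 1 / 10 ^ 9 ∧ |p - 0.4421413462| < 1 / 10 ^ 10 ∧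
      itineraryMinus a p p = primeString ∧ itineraryPlus a p p = oneZeros ∧
      ∀ n : ℕ, 1 ≤ n → (n.Prime ↔ p < (overlapMinus a p)^[n - 1] p) := by
  refine ⟨isAdmissible_primeString_oneZeros, not_isNull_primeString_oneZeros, ?_⟩
  obtain ⟨r, hlo, hhi, hr⟩ := exists_stringSeries_primeString_eq_one
  have h0 : 0 < r := by linarith
  have h1 : r < 1 := by linarith
  have hp : 0 < 1 - r := by linarith
  have hside := primeString_eq_one_iff_one_lt_stringSeries h0 (by linarith) hr
  have horbit := overlapMinus_iterate h0 h1 hr hside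
  have hprime : ∀ n, primeString n = 1 ↔
      1 - r < (overlapMinus (1 / r) (1 - r))^[n] (1 - r) := fun n => by
    rw [horbit, hside, lt_mul_iff_one_lt_right hp]
  refine ⟨r, 1 / r, 1 - r, isLeast_of_stringSeries_primeString_eq_one h0.le h1 hr, rfl,
    by rw [hr, mul_one], isOverlapping_one_div (by linarith) h1, ?_, ?_, ?_,
    itineraryPlus_critical h0 h1, ?_⟩
  · rw [abs_lt, lt_sub_iff_add_lt, sub_lt_iff_lt_add, lt_div_iff₀ h0, div_lt_iff₀ h0]
    constructor <;> linarith
  · rw [abs_lt]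
    constructor <;> linarith
  · funext n
    have hnonneg : 0 ≤ (overlapMinus (1 / r) (1 - r))^[n] (1 - r) := by
      rw [horbit]
      exact mul_nonneg hp.le (stringSeries_nonneg _ h0.le)
    by_cases hn : primeString n = 1
    · rw [itineraryMinus, if_neg fun hmem => ((hprime n).1 hn).not_ge hmem.2, hn]
    · rw [itineraryMinus, if_pos ⟨hnonneg, not_lt.1 (mt (hprime n).2 hn)⟩,
        fin_two_eq_zero_of_ne_one hn]
  · intro n hn
    rw [← hprime, primeString_eq_one_iff, Nat.sub_add_cancel hn]
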